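/- Let $\gamma\colon S^1=\mathbb R/2\pi\mathbb Z\to\mathbb R^2$ be a smooth, embedded, strictly convex closed curve, that is, a smooth injective parametrization $x\mapsto\gamma(x)$ of the boundary of a compact convex set, running counterclockwise with nowhere vanishing curvature: $[\gamma_x,\gamma_{xx}]>0$ everywhere, where $[\cdot,\cdot]$ denotes the standard determinant on $\mathbb R^2$. Let $g=[\gamma_x,\gamma_{xx}]^{1/3}$ be its equi-affine metric, let $s$ be the equi-affine arc-length parameter, $ds=g\,dx$, so that $\gamma_s=g^{-1}\gamma_x$, and let $\sigma=[\gamma,\gamma_s]$ be its affine support function with respect to the origin (the origin may lie anywhere in the plane). If $\gamma$ encloses a region of area $A_0$, then there exists a point $x_0$ on the curve such that $$\sigma(x_0)=\pi^{-2/3}A_0^{2/3}.$$ -/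

import Mathlib

open Set MeasureTheory

noncomputable section

/-- The standard determinant `[u, v]` on `ℝ²`. -/
def bracket (u v : ℝ × ℝ) : ℝ := u.1 * v.2 - u.2 * v.1

/-- Smooth, embedded, strictly convex closed curves `S¹ = ℝ / 2πℤ → ℝ²`, written as `2π`-periodic
maps of the parameter `x ∈ ℝ`: the map is smooth and injective on the circle, it traces the
boundary of a compact convex set, and `[γ_x, γ_xx] > 0` everywhere, that is, it is regular, runs
counterclockwise and its curvature vanishes nowhere. -/
structure IsStrictlyConvexCurve (γ : ℝ → ℝ × ℝ) : Prop where
  smooth : ContDiff ℝ (⊤ : ℕ∞) γ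
  periodic : Function.Periodic γ (2 * Real.pi)
  injOn : InjOn γ (Ico 0 (2 * Real.pi))
  convex : ∃ K : Set (ℝ × ℝ), IsCompact K ∧ Convex ℝ K ∧ frontier K = range γ
  bracket_pos : ∀ x, 0 < bracket (deriv γ x) (deriv (deriv γ) x)

/-- The region enclosed by `γ`: the points off the curve whose connected component in the
complement of the curve is bounded. -/
def enclosedRegion (γ : ℝ → ℝ × ℝ) : Set (ℝ × ℝ) :=
  {p | p ∉ range γ ∧ Bornology.IsBounded (connectedComponentIn (range γ)ᶜ p)}

/-- The enclosed area (Lebesgue measure of the enclosed region). -/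
def enclosedArea (γ : ℝ → ℝ × ℝ) : ℝ := volume.real (enclosedRegion γ)

/-- The equi-affine metric `g = [γ_x, γ_xx] ^ (1/3)`. -/
def equiAffineMetric (γ : ℝ → ℝ × ℝ) (x : ℝ) : ℝ :=
  bracket (deriv γ x) (deriv (deriv γ) x) ^ (1 / 3 : ℝ)

/-- The equi-affine tangent `γ_s`, the derivative of `γ` in the equi-affine arc-length parameter
`s = ∫ g dx`, so that `∂_s = g⁻¹ ∂_x`. -/
def equiAffineTangent (γ : ℝ → ℝ × ℝ) (x : ℝ) : ℝ × ℝ :=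
  (equiAffineMetric γ x)⁻¹ • deriv γ x

/-- The affine support function `σ = [γ, γ_s]` (with respect to the origin). -/
def affineSupport (γ : ℝ → ℝ × ℝ) (x : ℝ) : ℝ :=
  bracket (γ x) (equiAffineTangent γ x)

end

open Filter Topology

/-! Write `P = [γ, γ_x]` and `B = [γ_x, γ_xx]`. Then `P ^ 3 = σ ^ 3 B`, and the integral of `P` over
a period is twice the area `A`. It suffices to show that `σ ≤ c` forces `A ≤ π c ^ (3/2)` for `c >
0`, and that `σ ≥ c > 0` forces the reverse. The value in question then lies between the minimum and
the maximum of the continuous function `σ`.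

Both bounds are Sturm comparison. Put `l = c ^ (3/2)`. Where `P > 0`, the parameter `θ` with `dθ = P
dx / l` turns the curve into a solution of `γ_θθ = -(c / σ) ^ 3 γ`, to be compared with `γ_θθ = -γ`.
The Prüfer angle of the first coordinate `f` is `arctan (f / f_θ) = arctan (f P / (l f_x))`; it
moves at least as fast as `θ` if `σ ≤ c`, at most as fast if `σ ≥ c` (`hasDerivAt_pruefer`). By
convexity `f_x` vanishes exactly twice per period (`exists_monotone_arcs`). On each of the two arcs
the angle varies by at most `π`, and by exactly `π` when `P > 0`, so the integral of `P` over an arc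
is compared with `l π`. -/

theorem LinearMap.apply_prod_real (l : ℝ × ℝ →ₗ[ℝ] ℝ) (v : ℝ × ℝ) :
    l v = v.1 * l (1, 0) + v.2 * l (0, 1) := by
  have : v = v.1 • ((1 : ℝ), (0 : ℝ)) + v.2 • ((0 : ℝ), (1 : ℝ)) := by ext <;> simp
  conv_lhs => rw [this]
  simp only [map_add, map_smul, smul_eq_mul]

theorem LinearMap.eq_zero_of_bracket_ne_zero (l : ℝ × ℝ →ₗ[ℝ] ℝ) {u v : ℝ × ℝ}
    (huv : bracket u v ≠ 0) (hu : l u = 0) (hv : l v = 0) : l = 0 := by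
  rw [l.apply_prod_real] at hu hv
  unfold bracket at huv
  have h1 : l (1, 0) = 0 := by
    refine (mul_eq_zero.1 (?_ : (u.1 * v.2 - u.2 * v.1) * l (1, 0) = 0)).resolve_left huv
    linear_combination v.2 * hu - u.2 * hv
  have h2 : l (0, 1) = 0 := by
    refine (mul_eq_zero.1 (?_ : (u.1 * v.2 - u.2 * v.1) * l (0, 1) = 0)).resolve_left huv
    linear_combination u.1 * hv - v.1 * hu
  refine LinearMap.ext fun w => ?_
  rw [l.apply_prod_real, h1, h2]
  simp

theorem HasDerivAt.linearMap_comp_prod (l : ℝ × ℝ →ₗ[ℝ] ℝ) {γ : ℝ → ℝ × ℝ} {γ' : ℝ × ℝ} {x : ℝ}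
    (h : HasDerivAt γ γ' x) : HasDerivAt (fun t => l (γ t)) (l γ') x :=
  (LinearMap.toContinuousLinearMap l).hasFDerivAt.comp_hasDerivAt x h

/-! ### Regularity and supporting lines -/

namespace IsStrictlyConvexCurve

variable {γ : ℝ → ℝ × ℝ}

theorem hasDerivAt (hγ : IsStrictlyConvexCurve γ) (x : ℝ) : HasDerivAt γ (deriv γ x) x :=
  (hγ.smooth.differentiable (by simp)).differentiableAt.hasDerivAt

theorem contDiff_deriv (hγ : IsStrictlyConvexCurve γ) : ContDiff ℝ (⊤ : ℕ∞) (deriv γ) :=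
  (contDiff_infty_iff_deriv.1 hγ.smooth).2

theorem hasDerivAt_deriv (hγ : IsStrictlyConvexCurve γ) (x : ℝ) :
    HasDerivAt (deriv γ) (deriv (deriv γ) x) x :=
  (hγ.contDiff_deriv.differentiable (by simp)).differentiableAt.hasDerivAt

theorem continuous_deriv_deriv (hγ : IsStrictlyConvexCurve γ) : Continuous (deriv (deriv γ)) :=
  (contDiff_infty_iff_deriv.1 hγ.contDiff_deriv).2.continuous

theorem continuous (hγ : IsStrictlyConvexCurve γ) : Continuous γ := hγ.smooth.continuous

theorem continuous_deriv (hγ : IsStrictlyConvexCurve γ) : Continuous (deriv γ) :=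
  hγ.contDiff_deriv.continuous

theorem periodic_deriv (hγ : IsStrictlyConvexCurve γ) :
    Function.Periodic (deriv γ) (2 * Real.pi) := fun x => by
  rw [← deriv_comp_add_const, hγ.periodic.funext]

/-- Differentiating twice shows that `l` kills `γ_x` and `γ_xx`, which form a basis. This excludes
straight pieces of the curve. -/
theorem linearMap_eq_zero_of_const (hγ : IsStrictlyConvexCurve γ) (l : ℝ × ℝ →ₗ[ℝ] ℝ) {x c : ℝ}
    (h : ∀ᶠ t in 𝓝 x, l (γ t) = c) : l = 0 := by
  have h1 : ∀ᶠ t in 𝓝 x, l (deriv γ t) = 0 := by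
    filter_upwards [h.eventually_nhds] with t ht
    exact ((hγ.hasDerivAt t).linearMap_comp_prod l).unique
      ((hasDerivAt_const t c).congr_of_eventuallyEq ht)
  have h2 : l (deriv (deriv γ) x) = 0 :=
    ((hγ.hasDerivAt_deriv x).linearMap_comp_prod l).unique
      ((hasDerivAt_const x 0).congr_of_eventuallyEq h1)
  exact l.eq_zero_of_bracket_ne_zero (hγ.bracket_pos x).ne' h1.self_of_nhds h2

theorem interior_nonempty (hγ : IsStrictlyConvexCurve γ) {K : Set (ℝ × ℝ)} (hc : IsCompact K)
    (hK : Convex ℝ K) (hf : frontier K = range γ) : (interior K).Nonempty := by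
  rw [hK.interior_nonempty_iff_affineSpan_eq_top]
  have hmem : ∀ t, γ t ∈ K := fun t => hc.isClosed.frontier_subset (hf ▸ mem_range_self t)
  by_contra hne
  have hdir : (affineSpan ℝ K).direction ≠ ⊤ := by
    rwa [Ne, AffineSubspace.direction_eq_top_iff_of_nonempty
      ((affineSpan_nonempty ℝ).2 ⟨_, hmem 0⟩)]
  obtain ⟨l, hl0, hl⟩ := Submodule.exists_le_ker_of_lt_top _ hdir.lt_top
  refine hl0 (hγ.linearMap_eq_zero_of_const l (x := 0) (c := l (γ 0)) (Eventually.of_forall ?_))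
  intro t
  have := hl (AffineSubspace.vsub_mem_direction (subset_affineSpan ℝ K (hmem t))
    (subset_affineSpan ℝ K (hmem 0)))
  simpa [sub_eq_zero] using this

/-- The tangent line supports `K` on the left. A Hahn–Banach functional maximal at `γ x` kills
`γ_x`, hence is a multiple of `[γ_x, ·]`; its second derivative along the curve fixes the sign of
the multiple. -/
theorem bracket_sub_nonneg (hγ : IsStrictlyConvexCurve γ) {K : Set (ℝ × ℝ)} (hc : IsCompact K)
    (hK : Convex ℝ K) (hf : frontier K = range γ) (x : ℝ) {z : ℝ × ℝ} (hz : z ∈ K) :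
    0 ≤ bracket (deriv γ x) (z - γ x) := by
  have hx : γ x ∈ frontier K := hf ▸ mem_range_self x
  have hmem : ∀ t, γ t ∈ K := fun t => hc.isClosed.frontier_subset (hf ▸ mem_range_self t)
  have hint := hγ.interior_nonempty hc hK hf
  obtain ⟨l, hl⟩ := geometric_hahn_banach_open_point hK.interior isOpen_interior hx.2
  have hle : ∀ w ∈ K, l w ≤ l (γ x) := by
    intro w hw
    have : w ∈ closure (interior K) := by
      rw [hK.closure_interior_eq_closure_of_nonempty_interior hint]
      exact subset_closure hw
    exact closure_minimal (fun a ha => (hl a ha).le)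
      (isClosed_le l.continuous continuous_const) this
  have hl0 : (l : ℝ × ℝ →ₗ[ℝ] ℝ) ≠ 0 := by
    intro h0
    obtain ⟨a, ha⟩ := hint
    have := hl a ha
    have e : ∀ v, l v = 0 := fun v => LinearMap.congr_fun h0 v
    simp [e] at this
  have hd1 : ∀ t, HasDerivAt (fun t => l (γ t)) (l (deriv γ t)) t := fun t =>
    (hγ.hasDerivAt t).linearMap_comp_prod (l : ℝ × ℝ →ₗ[ℝ] ℝ)
  have hd2 : ∀ t, HasDerivAt (fun t => l (deriv γ t)) (l (deriv (deriv γ) t)) t := fun t =>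
    (hγ.hasDerivAt_deriv t).linearMap_comp_prod (l : ℝ × ℝ →ₗ[ℝ] ℝ)
  have hcrit : l (deriv γ x) = 0 :=
    IsLocalMax.hasDerivAt_eq_zero (Eventually.of_forall fun t => hle _ (hmem t)) (hd1 x)
  have hsecond : l (deriv (deriv γ) x) ≤ 0 := by
    by_contra! hpos
    have e1 : deriv (fun t => l (γ t)) = fun t => l (deriv γ t) := funext fun t => (hd1 t).deriv
    -- A local minimum that is also a global maximum makes `l ∘ γ` locally constant.
    have hmin : IsLocalMin (fun t => l (γ t)) x := by
      refine isLocalMin_of_deriv_deriv_pos ?_ ?_ (hd1 x).continuousAt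
      · rwa [e1, (hd2 x).deriv]
      · rw [e1]; exact hcrit
    refine hl0 (hγ.linearMap_eq_zero_of_const (l : ℝ × ℝ →ₗ[ℝ] ℝ) (x := x) (c := l (γ x)) ?_)
    filter_upwards [hmin] with t ht using le_antisymm (hle _ (hmem t)) ht
  have hB := hγ.bracket_pos x
  have hz' := hle z hz
  have hsub : l (z - γ x) ≤ 0 := by rw [map_sub]; linarith
  -- Expand in the basis `deriv γ x, deriv (deriv γ) x`.
  have key : bracket (deriv γ x) (deriv (deriv γ) x) * l (z - γ x) =
      bracket (deriv γ x) (z - γ x) * l (deriv (deriv γ) x) := by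
    have E := fun v => LinearMap.apply_prod_real (l : ℝ × ℝ →ₗ[ℝ] ℝ) v
    simp only [ContinuousLinearMap.coe_coe] at E
    rw [E] at hcrit
    rw [E (z - γ x), E (deriv (deriv γ) x)]
    unfold bracket
    linear_combination ((z - γ x).1 * (deriv (deriv γ) x).2
      - (z - γ x).2 * (deriv (deriv γ) x).1) * hcrit
  have hneg : l (deriv (deriv γ) x) < 0 := by
    refine lt_of_le_of_ne hsecond fun h0 => hl0 ?_
    exact LinearMap.eq_zero_of_bracket_ne_zero _ hB.ne' hcrit h0
  by_contra! hlt
  have := mul_pos_of_neg_of_neg hlt hneg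
  rw [← key] at this
  nlinarith

end IsStrictlyConvexCurve

/-! ### Sturm comparison by the Prüfer angle -/

/-- Derivative of the Prüfer angle. With `P = f h' - h f'` and `B = f' h'' - h' f''`, the function
`l * arctan (f P / (l f'))` grows faster or slower than `P`, according to the sign of
`l ^ 2 B - P ^ 3`. -/
theorem hasDerivAt_pruefer {f h f₁ h₁ : ℝ → ℝ} {f₂ h₂ l x : ℝ} (hl : 0 < l)
    (hf : HasDerivAt f (f₁ x) x) (hh : HasDerivAt h (h₁ x) x)
    (hf₁ : HasDerivAt f₁ f₂ x) (hh₁ : HasDerivAt h₁ h₂ x) (hne : f₁ x ≠ 0) :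
    HasDerivAt
      (fun t => l * Real.arctan (f t * (f t * h₁ t - h t * f₁ t) / (l * f₁ t)))
      ((f x * h₁ x - h x * f₁ x) +
        f x ^ 2 * (l ^ 2 * (f₁ x * h₂ - h₁ x * f₂) - (f x * h₁ x - h x * f₁ x) ^ 3) /
          (l ^ 2 * f₁ x ^ 2 + f x ^ 2 * (f x * h₁ x - h x * f₁ x) ^ 2)) x := by
  have hd := (((hf.mul ((hf.mul hh₁).sub (hh.mul hf₁))).div (hf₁.const_mul l)
    (mul_ne_zero hl.ne' hne)).arctan).const_mul l
  refine hd.congr_deriv ?_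
  simp only [Pi.mul_apply, Pi.sub_apply, Pi.div_apply]
  have hden : l ^ 2 * f₁ x ^ 2 + f x ^ 2 * (f x * h₁ x - h x * f₁ x) ^ 2 ≠ 0 := by positivity
  have hden' : 1 + (f x * (f x * h₁ x - h x * f₁ x) / (l * f₁ x)) ^ 2 ≠ 0 := by positivity
  have e : 1 + (f x * (f x * h₁ x - h x * f₁ x) / (l * f₁ x)) ^ 2 =
      (l ^ 2 * f₁ x ^ 2 + f x ^ 2 * (f x * h₁ x - h x * f₁ x) ^ 2) / (l * f₁ x) ^ 2 := by
    field_simp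
  rw [e]
  field_simp
  ring

section

variable {f h f₁ h₁ f₂ h₂ : ℝ → ℝ} {l a b : ℝ}

/-- The Prüfer function minus the primitive of `P` is increasing, and `l * arctan` oscillates by at
most `l π`. No sign of `P` is needed, so the origin may lie outside the curve. -/
theorem integral_le_of_pruefer (hl : 0 < l) (hab : a < b)
    (hf : ∀ x, HasDerivAt f (f₁ x) x) (hh : ∀ x, HasDerivAt h (h₁ x) x)
    (hf₁ : ∀ x, HasDerivAt f₁ (f₂ x) x) (hh₁ : ∀ x, HasDerivAt h₁ (h₂ x) x)
    (hne : ∀ x ∈ Ioo a b, f₁ x ≠ 0)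
    (hle : ∀ x, (f x * h₁ x - h x * f₁ x) ^ 3 ≤ l ^ 2 * (f₁ x * h₂ x - h₁ x * f₂ x)) :
    ∫ x in a..b, (f x * h₁ x - h x * f₁ x) ≤ l * Real.pi := by
  have cP : Continuous fun x => f x * h₁ x - h x * f₁ x :=
    ((continuous_iff_continuousAt.2 fun x => (hf x).continuousAt).mul
      (continuous_iff_continuousAt.2 fun x => (hh₁ x).continuousAt)).sub
    ((continuous_iff_continuousAt.2 fun x => (hh x).continuousAt).mul
      (continuous_iff_continuousAt.2 fun x => (hf₁ x).continuousAt))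
  set G : ℝ → ℝ := fun x => ∫ t in a..x, (f t * h₁ t - h t * f₁ t) with hG
  have hGd : ∀ x, HasDerivAt G (f x * h₁ x - h x * f₁ x) x := fun x =>
    cP.integral_hasStrictDerivAt a x |>.hasDerivAt
  set q : ℝ → ℝ := fun t => l * Real.arctan (f t * (f t * h₁ t - h t * f₁ t) / (l * f₁ t))
  have hd := fun x (hx : x ∈ Ioo a b) =>
    (hasDerivAt_pruefer hl (hf x) (hh x) (hf₁ x) (hh₁ x) (hne x hx)).sub (hGd x)
  have hmono : MonotoneOn (q - G) (Ioo a b) := by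
    refine monotoneOn_of_deriv_nonneg (convex_Ioo a b)
      (fun x hx => (hd x hx).continuousAt.continuousWithinAt)
      (fun x hx => (hd x (interior_subset hx)).differentiableAt.differentiableWithinAt) ?_
    intro x hx
    rw [(hd x (interior_subset hx)).deriv, add_sub_cancel_left]
    exact div_nonneg (mul_nonneg (sq_nonneg _) (sub_nonneg.2 (hle x))) (by positivity)
  have hbound : ∀ x ∈ Ioo a b, ∀ y ∈ Ioo a b, x ≤ y → G y - G x ≤ l * Real.pi := by
    intro x hx y hy hxy
    have h1 := hmono hx hy hxy
    simp only [Pi.sub_apply, q] at h1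
    have h2 := mul_le_mul_of_nonneg_left (Real.arctan_lt_pi_div_two
      (f y * (f y * h₁ y - h y * f₁ y) / (l * f₁ y))).le hl.le
    have h3 := mul_le_mul_of_nonneg_left (Real.neg_pi_div_two_lt_arctan
      (f x * (f x * h₁ x - h x * f₁ x) / (l * f₁ x))).le hl.le
    linarith
  have cG : Continuous G := continuous_iff_continuousAt.2 fun x => (hGd x).continuousAt
  -- The quotient inside `arctan` may be singular at `a` and `b`, so the bound is proved inside the
  -- arc and passed to the limit one endpoint at a time.
  have hb : ∀ x ∈ Ioo a b, G b - G x ≤ l * Real.pi := fun x hx =>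
    le_of_tendsto ((cG.tendsto b).mono_left (nhdsWithin_le_nhds (s := Iio b)) |>.sub_const (G x))
      (by
        filter_upwards [Ioo_mem_nhdsLT hx.2] with y hy
        exact hbound x hx y ⟨hx.1.trans hy.1, hy.2⟩ hy.1.le)
  have ha : G b - G a ≤ l * Real.pi :=
    le_of_tendsto ((cG.tendsto a).mono_left (nhdsWithin_le_nhds (s := Ioi a)) |>.const_sub (G b))
      (by filter_upwards [Ioo_mem_nhdsGT hab] with x hx using hb x hx)
  simpa [hG] using ha

/-- For a lower bound the angle must sweep all of `(-π/2, π/2)`. The signs of `f` at the ends, with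
`P > 0` and `f₁` tending to `0` from below, send the quotient to `-∞` at `a` and to `+∞` at `b`. -/
theorem le_integral_of_pruefer (hl : 0 < l) (hab : a < b)
    (hf : ∀ x, HasDerivAt f (f₁ x) x) (hh : ∀ x, HasDerivAt h (h₁ x) x)
    (hf₁ : ∀ x, HasDerivAt f₁ (f₂ x) x) (hh₁ : ∀ x, HasDerivAt h₁ (h₂ x) x)
    (hneg : ∀ x ∈ Ioo a b, f₁ x < 0) (h₁a : f₁ a = 0) (h₁b : f₁ b = 0)
    (hP : ∀ x, 0 < f x * h₁ x - h x * f₁ x) (hfa : 0 < f a) (hfb : f b < 0)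
    (hle : ∀ x, l ^ 2 * (f₁ x * h₂ x - h₁ x * f₂ x) ≤ (f x * h₁ x - h x * f₁ x) ^ 3) :
    l * Real.pi ≤ ∫ x in a..b, (f x * h₁ x - h x * f₁ x) := by
  have cf₁ : Continuous f₁ := continuous_iff_continuousAt.2 fun x => (hf₁ x).continuousAt
  have cf : Continuous f := continuous_iff_continuousAt.2 fun x => (hf x).continuousAt
  have cP : Continuous fun x => f x * h₁ x - h x * f₁ x :=
    (cf.mul (continuous_iff_continuousAt.2 fun x => (hh₁ x).continuousAt)).sub
    ((continuous_iff_continuousAt.2 fun x => (hh x).continuousAt).mul cf₁)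
  set G : ℝ → ℝ := fun x => ∫ t in a..x, (f t * h₁ t - h t * f₁ t) with hG
  have hGd : ∀ x, HasDerivAt G (f x * h₁ x - h x * f₁ x) x := fun x =>
    cP.integral_hasStrictDerivAt a x |>.hasDerivAt
  set r : ℝ → ℝ := fun t => f t * (f t * h₁ t - h t * f₁ t) / (l * f₁ t) with hr
  have hd := fun x (hx : x ∈ Ioo a b) =>
    (hasDerivAt_pruefer hl (hf x) (hh x) (hf₁ x) (hh₁ x) (hneg x hx).ne).sub (hGd x)
  have hanti : AntitoneOn ((fun t => l * Real.arctan (r t)) - G) (Ioo a b) := by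
    refine antitoneOn_of_deriv_nonpos (convex_Ioo a b)
      (fun x hx => (hd x hx).continuousAt.continuousWithinAt)
      (fun x hx => (hd x (interior_subset hx)).differentiableAt.differentiableWithinAt) ?_
    intro x hx
    rw [(hd x (interior_subset hx)).deriv, add_sub_cancel_left]
    exact div_nonpos_of_nonpos_of_nonneg
      (mul_nonpos_of_nonneg_of_nonpos (sq_nonneg _) (sub_nonpos.2 (hle x))) (by positivity)
  have hbound : ∀ x ∈ Ioo a b, ∀ y ∈ Ioo a b, x ≤ y →
      l * Real.arctan (r y) - l * Real.arctan (r x) ≤ G y - G x := by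
    intro x hx y hy hxy
    have h1 := hanti hx hy hxy
    simp only [Pi.sub_apply] at h1
    linarith
  have cG : Continuous G := continuous_iff_continuousAt.2 fun x => (hGd x).continuousAt
  have hinv : ∀ c : ℝ, ∀ s : Set ℝ, f₁ c = 0 → (∀ᶠ x in 𝓝[s] c, f₁ x < 0) →
      Tendsto (fun x => (l * f₁ x)⁻¹) (𝓝[s] c) atBot := by
    intro c s hc hs
    refine tendsto_inv_nhdsLT_zero.comp (tendsto_nhdsWithin_iff.2 ⟨?_, ?_⟩)
    · have := ((cf₁.const_mul l).tendsto c).mono_left (nhdsWithin_le_nhds (s := s))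
      simpa [hc] using this
    · filter_upwards [hs] with x hx using mul_neg_of_pos_of_neg hl hx
  have hN : ∀ c : ℝ, ∀ s : Set ℝ, Tendsto (fun x => f x * (f x * h₁ x - h x * f₁ x)) (𝓝[s] c)
      (𝓝 (f c * (f c * h₁ c - h c * f₁ c))) := fun c s =>
    ((cf.mul cP).tendsto c).mono_left nhdsWithin_le_nhds
  have hrb : Tendsto r (𝓝[<] b) atTop := by
    refine Tendsto.neg_mul_atBot (mul_neg_of_neg_of_pos hfb (hP b)) (hN b _) (hinv b _ h₁b ?_)
    filter_upwards [Ioo_mem_nhdsLT hab] with x hx using hneg x hx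
  have hra : Tendsto r (𝓝[>] a) atBot := by
    refine Tendsto.pos_mul_atBot (mul_pos hfa (hP a)) (hN a _) (hinv a _ h₁a ?_)
    filter_upwards [Ioo_mem_nhdsGT hab] with x hx using hneg x hx
  have hb : ∀ x ∈ Ioo a b, l * (Real.pi / 2) - l * Real.arctan (r x) ≤ G b - G x := fun x hx =>
    le_of_tendsto_of_tendsto
      (((Real.tendsto_arctan_atTop.mono_right nhdsWithin_le_nhds).comp hrb
        |>.const_mul l).sub_const _)
      ((cG.tendsto b).mono_left (nhdsWithin_le_nhds (s := Iio b)) |>.sub_const (G x))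
      (by
        filter_upwards [Ioo_mem_nhdsLT hx.2] with y hy
        exact hbound x hx y ⟨hx.1.trans hy.1, hy.2⟩ hy.1.le)
  have ha : l * (Real.pi / 2) - l * (-(Real.pi / 2)) ≤ G b - G a :=
    le_of_tendsto_of_tendsto
      (((Real.tendsto_arctan_atBot.mono_right nhdsWithin_le_nhds).comp hra
        |>.const_mul l).const_sub _)
      ((cG.tendsto a).mono_left (nhdsWithin_le_nhds (s := Ioi a)) |>.const_sub (G b))
      (by filter_upwards [Ioo_mem_nhdsGT hab] with x hx using hb x hx)
  have hGa : G a = 0 := by simp [hG]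
  rw [hGa] at ha
  calc l * Real.pi = l * (Real.pi / 2) - l * (-(Real.pi / 2)) := by ring
    _ ≤ _ := by simpa using ha

end

/-! ### Splitting the curve into two monotone arcs -/

namespace IsStrictlyConvexCurve

variable {γ : ℝ → ℝ × ℝ}

theorem hasDerivAt_fst (hγ : IsStrictlyConvexCurve γ) (x : ℝ) :
    HasDerivAt (fun t => (γ t).1) (deriv γ x).1 x :=
  (hγ.hasDerivAt x).linearMap_comp_prod (LinearMap.fst ℝ ℝ ℝ)

theorem hasDerivAt_snd (hγ : IsStrictlyConvexCurve γ) (x : ℝ) :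
    HasDerivAt (fun t => (γ t).2) (deriv γ x).2 x :=
  (hγ.hasDerivAt x).linearMap_comp_prod (LinearMap.snd ℝ ℝ ℝ)

theorem hasDerivAt_deriv_fst (hγ : IsStrictlyConvexCurve γ) (x : ℝ) :
    HasDerivAt (fun t => (deriv γ t).1) (deriv (deriv γ) x).1 x :=
  (hγ.hasDerivAt_deriv x).linearMap_comp_prod (LinearMap.fst ℝ ℝ ℝ)

theorem hasDerivAt_deriv_snd (hγ : IsStrictlyConvexCurve γ) (x : ℝ) :
    HasDerivAt (fun t => (deriv γ t).2) (deriv (deriv γ) x).2 x :=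
  (hγ.hasDerivAt_deriv x).linearMap_comp_prod (LinearMap.snd ℝ ℝ ℝ)

theorem injOn_Ico (hγ : IsStrictlyConvexCurve γ) (c : ℝ) :
    InjOn γ (Ico c (c + 2 * Real.pi)) := by
  intro x hx y hy hxy
  have hp := Real.two_pi_pos
  have hmod : ∀ z, γ (toIcoMod hp 0 z) = γ z := fun z => by
    rw [toIcoMod]
    exact hγ.periodic.sub_zsmul_eq _
  have hmem : ∀ z, toIcoMod hp 0 z ∈ Ico 0 (2 * Real.pi) := fun z => by
    simpa using toIcoMod_mem_Ico hp 0 z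
  have h := hγ.injOn (hmem x) (hmem y) (by rw [hmod, hmod, hxy])
  rw [toIcoMod_eq_toIcoMod] at h
  obtain ⟨n, hn⟩ := h
  rw [zsmul_eq_mul] at hn
  have h1 : (n : ℝ) < 1 := by nlinarith [hx.1, hy.2]
  have h2 : (-1 : ℝ) < n := by nlinarith [hx.2, hy.1]
  have h3 : n = 0 := by
    have : n < 1 := by exact_mod_cast h1
    have : -1 < n := by exact_mod_cast h2
    omega
  rw [h3] at hn
  simp only [Int.cast_zero, zero_mul] at hn
  linarith

theorem isMax_or_isMin_fst (hγ : IsStrictlyConvexCurve γ) {K : Set (ℝ × ℝ)} (hc : IsCompact K)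
    (hK : Convex ℝ K) (hf : frontier K = range γ) {x : ℝ} (hx : (deriv γ x).1 = 0) :
    (∀ z ∈ K, z.1 ≤ (γ x).1) ∨ (∀ z ∈ K, (γ x).1 ≤ z.1) := by
  have hB := hγ.bracket_pos x
  have key : ∀ z ∈ K, 0 ≤ -(deriv γ x).2 * (z.1 - (γ x).1) := fun z hz => by
    have := hγ.bracket_sub_nonneg hc hK hf x hz
    simpa [bracket, hx] using this
  have hne : (deriv γ x).2 ≠ 0 := by
    intro h0
    simp [bracket, hx, h0] at hB
  rcases hne.lt_or_gt with h | h
  · right; intro z hz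
    have := key z hz
    nlinarith
  · left; intro z hz
    have := key z hz
    nlinarith

/-- Zeros of `f_x` are isolated, since `B > 0` prevents `f_x` and `f_xx` from vanishing together;
compactness does the rest. -/
theorem finite_setOf_deriv_fst_eq_zero (hγ : IsStrictlyConvexCurve γ) (c d : ℝ) :
    {x ∈ Icc c d | (deriv γ x).1 = 0}.Finite := by
  by_contra hinf
  obtain ⟨x, -, hx⟩ := Set.Infinite.exists_accPt_of_subset_isCompact hinf
    (isCompact_Icc (a := c) (b := d)) (sep_subset _ _)
  rw [accPt_iff_frequently_nhdsNE] at hx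
  refine hx ?_
  by_cases h : (deriv γ x).1 = 0
  · have hB := hγ.bracket_pos x
    have hne : (deriv (deriv γ) x).1 ≠ 0 := by
      intro h0
      simp [bracket, h, h0] at hB
    filter_upwards [(hγ.hasDerivAt_deriv_fst x).eventually_ne (c := 0) hne] with y hy h'
    exact hy h'.2
  · filter_upwards [nhdsWithin_le_nhds
      ((hγ.hasDerivAt_deriv_fst x).continuousAt.eventually_ne h)] with y hy h'
    exact hy h'.2

theorem exists_mem_Ico_eq (hγ : IsStrictlyConvexCurve γ) (c : ℝ) {z : ℝ × ℝ} (hz : z ∈ range γ) :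
    ∃ x ∈ Ico c (c + 2 * Real.pi), γ x = z := by
  obtain ⟨y, rfl⟩ := hz
  obtain ⟨x, hx, hxy⟩ := hγ.periodic.exists_mem_Ico Real.two_pi_pos y c
  exact ⟨x, hx, hxy.symm⟩

/-- A vertical tangent supports `K`. If it met the curve twice, the whole segment between would lie
on the boundary and consist of points with vertical tangent, of which there are finitely many. -/
theorem eq_of_deriv_fst_eq_zero (hγ : IsStrictlyConvexCurve γ) {x y : ℝ}
    (hx : (deriv γ x).1 = 0) (hxy : (γ x).1 = (γ y).1) : γ x = γ y := by
  obtain ⟨K, hc, hK, hf⟩ := hγ.convex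
  have hmem : ∀ t, γ t ∈ K := fun t => hc.isClosed.frontier_subset (hf ▸ mem_range_self t)
  by_contra hne
  have hext : IsExtrOn Prod.fst K (γ x) := by
    rcases hγ.isMax_or_isMin_fst hc hK hf hx with h | h
    · exact Or.inr h
    · exact Or.inl h
  have hsub : segment ℝ (γ x) (γ y) ⊆
      γ '' {t ∈ Icc 0 (0 + 2 * Real.pi) | (deriv γ t).1 = 0} := by
    intro z hz
    have hzK : z ∈ K := hK.segment_subset (hmem x) (hmem y) hz
    have hz1 : z.1 = (γ x).1 := by
      obtain ⟨s, t, -, -, hst, rfl⟩ := hz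
      simp only [Prod.fst_add, Prod.smul_fst, ← hxy, smul_eq_mul]
      rw [← add_mul, hst, one_mul]
    have hextz : IsExtrOn Prod.fst K z := by
      rcases hext with h | h
      · exact Or.inl fun w hw => hz1.trans_le (h hw)
      · exact Or.inr fun w hw => (h hw).trans_eq hz1.symm
    have hzf : z ∈ frontier K := by
      refine ⟨subset_closure hzK, fun hzi => ?_⟩
      have h0 := (hextz.isLocalExtr (mem_interior_iff_mem_nhds.1 hzi)).hasFDerivAt_eq_zero
        (hasFDerivAt_fst (𝕜 := ℝ))
      have := DFunLike.congr_fun h0 (1, 0)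
      simp at this
    rw [hf] at hzf
    obtain ⟨t, ht, rfl⟩ := hγ.exists_mem_Ico_eq 0 hzf
    refine ⟨t, ⟨Ico_subset_Icc_self ht, ?_⟩, rfl⟩
    refine IsLocalExtr.hasDerivAt_eq_zero ?_ (hγ.hasDerivAt_fst t)
    rcases hextz with h | h
    · exact Or.inl (Eventually.of_forall fun w => h (hmem w))
    · exact Or.inr (Eventually.of_forall fun w => h (hmem w))
  have hfin := ((hγ.finite_setOf_deriv_fst_eq_zero 0 (0 + 2 * Real.pi)).image γ).subset hsub
  rw [segment_eq_image_lineMap] at hfin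
  exact (Icc_infinite zero_lt_one).image (AffineMap.lineMap_injective ℝ hne).injOn hfin

/-- The curve consists of two arcs, along which the first coordinate decreases and increases. -/
theorem exists_monotone_arcs (hγ : IsStrictlyConvexCurve γ) :
    ∃ a b, a < b ∧ b < a + 2 * Real.pi ∧ (deriv γ a).1 = 0 ∧ (deriv γ b).1 = 0 ∧
      (∀ x ∈ Ioo a b, (deriv γ x).1 < 0) ∧
      (∀ x ∈ Ioo b (a + 2 * Real.pi), 0 < (deriv γ x).1) := by
  obtain ⟨K, hc, hK, hf⟩ := hγ.convex
  have hmem : ∀ t, γ t ∈ K := fun t => hc.isClosed.frontier_subset (hf ▸ mem_range_self t)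
  have hp := Real.two_pi_pos
  have cf : Continuous fun t => (γ t).1 := continuous_fst.comp hγ.continuous
  have cf₁ : Continuous fun t => (deriv γ t).1 := continuous_fst.comp hγ.continuous_deriv
  obtain ⟨a, -, ha⟩ := (isCompact_Icc (a := 0) (b := 0 + 2 * Real.pi)).exists_isMaxOn
    (nonempty_Icc.2 (by linarith)) cf.continuousOn
  have hamax : ∀ x, (γ x).1 ≤ (γ a).1 := fun x => by
    obtain ⟨y, hy, hxy⟩ := hγ.exists_mem_Ico_eq 0 (mem_range_self x)
    rw [← hxy]
    exact ha (Ico_subset_Icc_self hy)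
  obtain ⟨b, hb', hb⟩ := (isCompact_Icc (a := a) (b := a + 2 * Real.pi)).exists_isMinOn
    (nonempty_Icc.2 (by linarith)) cf.continuousOn
  have hbmin : ∀ x, (γ b).1 ≤ (γ x).1 := fun x => by
    obtain ⟨y, hy, hxy⟩ := hγ.exists_mem_Ico_eq a (mem_range_self x)
    rw [← hxy]
    exact hb (Ico_subset_Icc_self hy)
  have hlt : (γ b).1 < (γ a).1 := by
    refine lt_of_le_of_ne (hbmin a) fun h => ?_
    have h0 := hγ.linearMap_eq_zero_of_const (LinearMap.fst ℝ ℝ ℝ) (x := 0) (c := (γ a).1)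
      (Eventually.of_forall fun t => le_antisymm (hamax t) (h ▸ hbmin t))
    have := LinearMap.congr_fun h0 (1, 0)
    simp at this
  have hap : γ (a + 2 * Real.pi) = γ a := hγ.periodic a
  have hab : a < b := lt_of_le_of_ne hb'.1 fun h => by
    rw [h] at hlt
    exact lt_irrefl _ hlt
  have hba : b < a + 2 * Real.pi := lt_of_le_of_ne hb'.2 fun h => by
    rw [h, hap] at hlt
    exact lt_irrefl _ hlt
  have ha₁ : (deriv γ a).1 = 0 :=
    IsLocalMax.hasDerivAt_eq_zero (Eventually.of_forall hamax) (hγ.hasDerivAt_fst a)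
  have hb₁ : (deriv γ b).1 = 0 :=
    IsLocalMin.hasDerivAt_eq_zero (Eventually.of_forall hbmin) (hγ.hasDerivAt_fst b)
  -- A vertical tangent occurs only at an extreme value of the first coordinate, and each extreme
  -- value is taken at one point per period.
  have hzero : ∀ x ∈ Ioo a (a + 2 * Real.pi), (deriv γ x).1 = 0 → x = b := by
    intro x hx hx0
    rcases hγ.isMax_or_isMin_fst hc hK hf hx0 with h | h
    · have := hγ.injOn_Ico a (Ioo_subset_Ico_self hx) ⟨le_rfl, by linarith⟩
        (hγ.eq_of_deriv_fst_eq_zero hx0 (le_antisymm (hamax x) (h _ (hmem a))))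
      exact absurd this hx.1.ne'
    · exact hγ.injOn_Ico a (Ioo_subset_Ico_self hx) ⟨hab.le, hba⟩
        (hγ.eq_of_deriv_fst_eq_zero hx0 (le_antisymm (h _ (hmem b)) (hbmin x)))
  refine ⟨a, b, hab, hba, ha₁, hb₁, ?_, ?_⟩
  · intro x hx
    by_contra! hx0
    obtain ⟨c, hcm, hc'⟩ := exists_hasDerivAt_eq_slope (fun t => (γ t).1) _ hab cf.continuousOn
      fun t _ => hγ.hasDerivAt_fst t
    have hneg : (deriv γ c).1 < 0 := by
      rw [hc']
      exact div_neg_of_neg_of_pos (by linarith) (by linarith)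
    obtain ⟨y, hy, hy0⟩ := isPreconnected_Ioo.intermediate_value hcm hx cf₁.continuousOn
      ⟨hneg.le, hx0⟩
    exact hy.2.ne (hzero y ⟨hy.1, hy.2.trans hba⟩ hy0)
  · intro x hx
    by_contra! hx0
    obtain ⟨c, hcm, hc'⟩ := exists_hasDerivAt_eq_slope (fun t => (γ t).1) _ hba cf.continuousOn
      fun t _ => hγ.hasDerivAt_fst t
    have hpos : 0 < (deriv γ c).1 := by
      rw [hc', hap]
      exact div_pos (by linarith) (by linarith)
    obtain ⟨y, hy, hy0⟩ := isPreconnected_Ioo.intermediate_value hx hcm cf₁.continuousOn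
      ⟨hx0, hpos.le⟩
    exact hy.1.ne' (hzero y ⟨hab.trans hy.1, hy.2⟩ hy0)

end IsStrictlyConvexCurve

/-! ### The enclosed region and its area -/

namespace IsStrictlyConvexCurve

variable {γ : ℝ → ℝ × ℝ}

/-- The complement of the curve is the disjoint union of the open sets `interior K` and `Kᶜ`. A
point outside `K` lies in an open half-plane missing the curve, so its component is unbounded. -/
theorem enclosedRegion_eq_interior {K : Set (ℝ × ℝ)} (hc : IsCompact K)
    (hK : Convex ℝ K) (hf : frontier K = range γ) : enclosedRegion γ = interior K := by
  have hcompl : (range γ)ᶜ = interior K ∪ Kᶜ := by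
    rw [← hf, frontier, hc.isClosed.closure_eq, compl_sdiff]
  have hdisj : Disjoint (interior K) Kᶜ :=
    disjoint_compl_right.mono_left interior_subset
  ext p
  constructor
  · rintro ⟨hp, hbd⟩
    by_contra hpi
    have hpK : p ∉ K := by
      have : p ∈ interior K ∪ Kᶜ := hcompl ▸ hp
      exact this.resolve_left hpi
    obtain ⟨l, u, hlp, hlK⟩ := geometric_hahn_banach_point_closed hK hc.isClosed hpK
    have hl0 : ∃ w, l w < 0 := by
      by_contra! h
      have hz : ∀ w, l w = 0 := fun w => by
        have h1 := h w
        have h2 := h (-w)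
        rw [map_neg] at h2
        linarith
      have hfr : (frontier K).Nonempty := hf ▸ range_nonempty γ
      obtain ⟨k, hk⟩ := hfr
      have := hlK k (hc.isClosed.frontier_subset hk)
      rw [hz] at hlp this
      linarith
    obtain ⟨w, hw⟩ := hl0
    set S : Set (ℝ × ℝ) := {q | l q < u} with hS
    have hSc : IsPreconnected S := (convex_halfSpace_lt l.isLinear u).isPreconnected
    have hSsub : S ⊆ (range γ)ᶜ := fun q hq hqr =>
      lt_asymm hq (hlK q (hc.isClosed.frontier_subset (hf ▸ hqr)))
    have hbS : Bornology.IsBounded S :=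
      hbd.subset (hSc.subset_connectedComponentIn hlp hSsub)
    -- Moving in a direction where `l` decreases never leaves the half-plane.
    have hray : ∀ t : ℝ, 0 ≤ t → p + t • w ∈ S := fun t ht => by
      simp only [hS, mem_ofPred_eq, map_add, map_smul, smul_eq_mul]
      nlinarith
    obtain ⟨R, hR⟩ := hbS.exists_norm_le
    have hw0 : 0 < ‖w‖ := norm_pos_iff.2 fun h => by simp [h] at hw
    have hR0 : 0 ≤ R := (norm_nonneg p).trans (hR p hlp)
    have h1 := hR _ (hray ((2 * R + 1) / ‖w‖) (by positivity))
    have h2 : ‖((2 * R + 1) / ‖w‖) • w‖ = 2 * R + 1 := by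
      rw [norm_smul, Real.norm_of_nonneg (by positivity)]
      field_simp
    have h3 : ‖((2 * R + 1) / ‖w‖) • w‖ ≤ ‖p + ((2 * R + 1) / ‖w‖) • w‖ + ‖p‖ := by
      simpa using norm_sub_le (p + ((2 * R + 1) / ‖w‖) • w) p
    have h4 := hR p hlp
    linarith
  · intro hp
    have hpr : p ∈ (range γ)ᶜ := hcompl ▸ Or.inl hp
    refine ⟨hpr, hc.isBounded.subset (Subset.trans ?_ interior_subset)⟩
    exact isPreconnected_connectedComponentIn.subset_left_of_subset_union isOpen_interior
      hc.isClosed.isOpen_compl hdisj (hcompl ▸ connectedComponentIn_subset _ _)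
      ⟨p, mem_connectedComponentIn hpr, hp⟩

theorem enclosedArea_eq {K : Set (ℝ × ℝ)} (hc : IsCompact K)
    (hK : Convex ℝ K) (hf : frontier K = range γ) : enclosedArea γ = volume.real K := by
  rw [enclosedArea, enclosedRegion_eq_interior hc hK hf]
  exact measureReal_congr (interior_ae_eq_of_null_frontier (hK.addHaar_frontier volume))

end IsStrictlyConvexCurve

/-- Integral of a function of `f x` along a strictly monotone arc. -/
theorem integral_invFunOn_eq {f f₁ h : ℝ → ℝ} {a b : ℝ} (hf : ∀ x, HasDerivAt f (f₁ x) x)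
    (hinj : InjOn f (Ioo a b)) (hf₁ : Continuous f₁) (hh : Continuous h) :
    IntegrableOn (fun t => h (Function.invFunOn f (Ioo a b) t)) (f '' Ioo a b) ∧
    ∫ t in f '' Ioo a b, h (Function.invFunOn f (Ioo a b) t) = ∫ x in Ioo a b, |f₁ x| * h x := by
  have hd : ∀ x ∈ Ioo a b, HasDerivWithinAt f (f₁ x) (Ioo a b) x :=
    fun x _ => (hf x).hasDerivWithinAt
  have hinv : ∀ x ∈ Ioo a b, |f₁ x| • h (Function.invFunOn f (Ioo a b) (f x)) = |f₁ x| * h x :=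
    fun x hx => by rw [hinj.leftInvOn_invFunOn hx, smul_eq_mul]
  constructor
  · rw [integrableOn_image_iff_integrableOn_abs_deriv_smul measurableSet_Ioo hd hinj,
      integrableOn_congr_fun hinv measurableSet_Ioo]
    exact ((hf₁.abs.mul hh).integrableOn_Icc).mono_set Ioo_subset_Icc_self
  · rw [integral_image_eq_integral_abs_deriv_smul measurableSet_Ioo hd hinj]
    exact setIntegral_congr_fun measurableSet_Ioo hinv

theorem volume_real_eq_integral_of_slices {K : Set (ℝ × ℝ)} (hK : MeasurableSet K) {m M : ℝ}
    {u l : ℝ → ℝ} (hu : IntegrableOn u (Ioo m M)) (hl : IntegrableOn l (Ioo m M))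
    (hlu : ∀ t ∈ Ioo m M, l t ≤ u t) (hfst : ∀ z ∈ K, z.1 ∈ Icc m M)
    (hslice : ∀ t ∈ Ioo m M, Prod.mk t ⁻¹' K = Icc (l t) (u t)) :
    volume.real K = (∫ t in Ioo m M, u t) - ∫ t in Ioo m M, l t := by
  rw [← integral_sub hu hl, measureReal_def, Measure.volume_eq_prod, Measure.prod_apply hK]
  have hnn : 0 ≤ᵐ[volume.restrict (Ioo m M)] fun t => u t - l t :=
    (ae_restrict_iff' measurableSet_Ioo).2 (Eventually.of_forall fun t ht => sub_nonneg.2 (hlu t ht))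
  have h1 : ∫⁻ t, volume (Prod.mk t ⁻¹' K) = ∫⁻ t in Icc m M, volume (Prod.mk t ⁻¹' K) := by
    refine (setLIntegral_eq_of_support_subset fun t ht => ?_).symm
    obtain ⟨y, hy⟩ : (Prod.mk t ⁻¹' K).Nonempty := by
      by_contra h
      rw [not_nonempty_iff_eq_empty] at h
      simp [h] at ht
    exact hfst _ hy
  have h2 : ∫⁻ t in Icc m M, volume (Prod.mk t ⁻¹' K) =
      ∫⁻ t in Ioo m M, ENNReal.ofReal (u t - l t) := by
    rw [← restrict_Ioo_eq_restrict_Icc]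
    exact setLIntegral_congr_fun measurableSet_Ioo fun t ht => by
      simp only [hslice t ht, Real.volume_Icc]
  rw [h1, h2, integral_eq_lintegral_of_nonneg_ae hnn (hu.sub hl).aestronglyMeasurable]

theorem mk_mem_frontier_of_isExtrOn {K : Set (ℝ × ℝ)} {t y : ℝ} (hy : (t, y) ∈ K)
    (h : IsExtrOn id (Prod.mk t ⁻¹' K) y) : (t, y) ∈ frontier K := by
  refine ⟨subset_closure hy, fun hi => ?_⟩
  have hn : Prod.mk t ⁻¹' K ∈ 𝓝 y :=
    (Continuous.prodMk_right t).continuousAt.preimage_mem_nhds (mem_interior_iff_mem_nhds.1 hi)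
  exact one_ne_zero ((h.isLocalExtr hn).hasDerivAt_eq_zero (hasDerivAt_id y))

namespace IsStrictlyConvexCurve

variable {γ : ℝ → ℝ × ℝ}

theorem continuous_bracket_deriv (hγ : IsStrictlyConvexCurve γ) :
    Continuous fun x => bracket (γ x) (deriv γ x) :=
  ((continuous_fst.comp hγ.continuous).mul (continuous_snd.comp hγ.continuous_deriv)).sub
    ((continuous_snd.comp hγ.continuous).mul (continuous_fst.comp hγ.continuous_deriv))

/-- The region enclosed by the curve lies between the graphs traced by the two monotone arcs. -/
theorem enclosedArea_eq_integral_snd_mul (hγ : IsStrictlyConvexCurve γ) {a b : ℝ} (hab : a < b)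
    (hba : b < a + 2 * Real.pi) (ha : (deriv γ a).1 = 0) (hb : (deriv γ b).1 = 0)
    (hneg : ∀ x ∈ Ioo a b, (deriv γ x).1 < 0)
    (hpos : ∀ x ∈ Ioo b (a + 2 * Real.pi), 0 < (deriv γ x).1) :
    enclosedArea γ = -∫ x in a..(a + 2 * Real.pi), (γ x).2 * (deriv γ x).1 := by
  obtain ⟨K, hc, hK, hf⟩ := hγ.convex
  have hmem : ∀ t, γ t ∈ K := fun t => hc.isClosed.frontier_subset (hf ▸ mem_range_self t)
  have cf : Continuous fun t => (γ t).1 := continuous_fst.comp hγ.continuous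
  have ch : Continuous fun t => (γ t).2 := continuous_snd.comp hγ.continuous
  have cf₁ : Continuous fun t => (deriv γ t).1 := continuous_fst.comp hγ.continuous_deriv
  have hap : γ (a + 2 * Real.pi) = γ a := hγ.periodic a
  have hanti : StrictAntiOn (fun t => (γ t).1) (Icc a b) :=
    strictAntiOn_of_deriv_neg (convex_Icc a b) cf.continuousOn fun x hx => by
      rw [(hγ.hasDerivAt_fst x).deriv]
      exact hneg x (by rwa [interior_Icc] at hx)
  have hmono : StrictMonoOn (fun t => (γ t).1) (Icc b (a + 2 * Real.pi)) :=
    strictMonoOn_of_deriv_pos (convex_Icc _ _) cf.continuousOn fun x hx => by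
      rw [(hγ.hasDerivAt_fst x).deriv]
      exact hpos x (by rwa [interior_Icc] at hx)
  have hlt : (γ b).1 < (γ a).1 := hanti (left_mem_Icc.2 hab.le) (right_mem_Icc.2 hab.le) hab
  have himg₁ : (fun t => (γ t).1) '' Ioo a b = Ioo (γ b).1 (γ a).1 := by
    refine Subset.antisymm ?_ (intermediate_value_Ioo' hab.le cf.continuousOn)
    rintro _ ⟨x, hx, rfl⟩
    exact ⟨hanti (Ioo_subset_Icc_self hx) (right_mem_Icc.2 hab.le) hx.2,
      hanti (left_mem_Icc.2 hab.le) (Ioo_subset_Icc_self hx) hx.1⟩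
  have himg₂ : (fun t => (γ t).1) '' Ioo b (a + 2 * Real.pi) = Ioo (γ b).1 (γ a).1 := by
    rw [← hap]
    refine Subset.antisymm ?_ (intermediate_value_Ioo hba.le cf.continuousOn)
    rintro _ ⟨x, hx, rfl⟩
    exact ⟨hmono (left_mem_Icc.2 hba.le) (Ioo_subset_Icc_self hx) hx.1,
      hmono (Ioo_subset_Icc_self hx) (right_mem_Icc.2 hba.le) hx.2⟩
  have hinj₁ := hanti.injOn.mono Ioo_subset_Icc_self
  have hinj₂ := hmono.injOn.mono Ioo_subset_Icc_self
  obtain ⟨hi₁, he₁⟩ := integral_invFunOn_eq hγ.hasDerivAt_fst hinj₁ cf₁ ch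
  obtain ⟨hi₂, he₂⟩ := integral_invFunOn_eq hγ.hasDerivAt_fst hinj₂ cf₁ ch
  rw [himg₁] at hi₁ he₁
  rw [himg₂] at hi₂ he₂
  set u : ℝ → ℝ := fun t => (γ (Function.invFunOn (fun t => (γ t).1) (Ioo a b) t)).2
  set l : ℝ → ℝ := fun t =>
    (γ (Function.invFunOn (fun t => (γ t).1) (Ioo b (a + 2 * Real.pi)) t)).2
  have hu : ∀ x ∈ Ioo a b, u (γ x).1 = (γ x).2 := fun x hx =>
    congrArg (fun y => (γ y).2) (hinj₁.leftInvOn_invFunOn hx)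
  have hl : ∀ x ∈ Ioo b (a + 2 * Real.pi), l (γ x).1 = (γ x).2 := fun x hx =>
    congrArg (fun y => (γ y).2) (hinj₂.leftInvOn_invFunOn hx)
  have hlu : ∀ t ∈ Ioo (γ b).1 (γ a).1, l t ≤ u t := by
    intro t ht
    obtain ⟨x, hx, hxt⟩ := himg₁.symm ▸ ht
    obtain ⟨y, hy, hyt⟩ := himg₂.symm ▸ ht
    simp only at hxt hyt
    rw [← hyt, hl y hy, hyt, ← hxt, hu x hx]
    have h1 := hγ.bracket_sub_nonneg hc hK hf x (hmem y)
    simp only [bracket, Prod.fst_sub, Prod.snd_sub, hxt, hyt, sub_self, mul_zero, sub_zero] at h1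
    have h2 := hneg x hx
    nlinarith
  have hbd : ∀ z ∈ K, z.1 ∈ Icc (γ b).1 (γ a).1 := by
    intro z hz
    constructor
    · rcases hγ.isMax_or_isMin_fst hc hK hf hb with h | h
      · exact absurd (h _ (hmem a)) (not_le.2 hlt)
      · exact h z hz
    · rcases hγ.isMax_or_isMin_fst hc hK hf ha with h | h
      · exact h z hz
      · exact absurd (h _ (hmem b)) (not_le.2 hlt)
  -- Over an interior abscissa the boundary has one point on each arc. These bound the slice, since
  -- the extreme points of a slice lie on the frontier of `K`.
  have hends : ∀ t ∈ Ioo (γ b).1 (γ a).1, ∀ y, (t, y) ∈ frontier K → y = u t ∨ y = l t := by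
    intro t ht y hy
    rw [hf] at hy
    obtain ⟨x, hx, hxy⟩ := hγ.exists_mem_Ico_eq a hy
    have hx1 : (γ x).1 = t := by rw [hxy]
    have hx2 : (γ x).2 = y := by rw [hxy]
    have hxa : x ≠ a := by
      rintro rfl
      exact ht.2.ne hx1.symm
    have hxb : x ≠ b := by
      rintro rfl
      exact ht.1.ne hx1
    rcases hxb.lt_or_gt with h | h
    · left
      rw [← hx1, hu x ⟨lt_of_le_of_ne hx.1 hxa.symm, h⟩, hx2]
    · right
      rw [← hx1, hl x ⟨h, hx.2⟩, hx2]
  have hslice : ∀ t ∈ Ioo (γ b).1 (γ a).1, Prod.mk t ⁻¹' K = Icc (l t) (u t) := by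
    intro t ht
    have hut : u t ∈ Prod.mk t ⁻¹' K := by
      obtain ⟨x, hx, rfl⟩ := himg₁.symm ▸ ht
      simpa only [mem_preimage, hu x hx] using hmem x
    have hlt' : l t ∈ Prod.mk t ⁻¹' K := by
      obtain ⟨x, hx, rfl⟩ := himg₂.symm ▸ ht
      simpa only [mem_preimage, hl x hx] using hmem x
    have hconv : Convex ℝ (Prod.mk t ⁻¹' K) := by
      intro y hy z hz p q hp hq hpq
      have := hK hy hz hp hq hpq
      simp only [Prod.smul_mk, Prod.mk_add_mk, smul_eq_mul, ← add_mul, hpq, one_mul] at this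
      simpa using this
    have hcomp : IsCompact (Prod.mk t ⁻¹' K) := by
      refine (hc.image continuous_snd).of_isClosed_subset
        (hc.isClosed.preimage (Continuous.prodMk_right t)) ?_
      intro y hy
      exact ⟨(t, y), hy, rfl⟩
    refine Subset.antisymm (fun y hy => ⟨?_, ?_⟩) (hconv.ordConnected.out hlt' hut)
    · obtain ⟨z, hz, hzmin⟩ := hcomp.exists_isMinOn ⟨y, hy⟩ continuous_id.continuousOn
      have hzy : z ≤ y := hzmin hy
      rcases hends t ht z (mk_mem_frontier_of_isExtrOn hz (Or.inl hzmin)) with h | h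
      · linarith [hlu t ht]
      · linarith
    · obtain ⟨z, hz, hzmax⟩ := hcomp.exists_isMaxOn ⟨y, hy⟩ continuous_id.continuousOn
      have hzy : y ≤ z := hzmax hy
      rcases hends t ht z (mk_mem_frontier_of_isExtrOn hz (Or.inr hzmax)) with h | h
      · linarith
      · linarith [hlu t ht]
  rw [enclosedArea_eq hc hK hf, volume_real_eq_integral_of_slices hc.measurableSet hi₁ hi₂ hlu
    hbd hslice, he₁, he₂]
  have e₁ : ∫ x in Ioo a b, |(deriv γ x).1| * (γ x).2 =
      -∫ x in a..b, (γ x).2 * (deriv γ x).1 := by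
    rw [intervalIntegral.integral_of_le hab.le, integral_Ioc_eq_integral_Ioo, ← integral_neg]
    refine setIntegral_congr_fun measurableSet_Ioo fun x hx => ?_
    simp only [abs_of_neg (hneg x hx)]
    ring
  have e₂ : ∫ x in Ioo b (a + 2 * Real.pi), |(deriv γ x).1| * (γ x).2 =
      ∫ x in b..(a + 2 * Real.pi), (γ x).2 * (deriv γ x).1 := by
    rw [intervalIntegral.integral_of_le hba.le, integral_Ioc_eq_integral_Ioo]
    refine setIntegral_congr_fun measurableSet_Ioo fun x hx => ?_
    simp only [abs_of_pos (hpos x hx)]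
    ring
  have cm : Continuous fun x => (γ x).2 * (deriv γ x).1 := ch.mul cf₁
  rw [e₁, e₂, ← intervalIntegral.integral_add_adjacent_intervals
    (cm.intervalIntegrable a b) (cm.intervalIntegrable b (a + 2 * Real.pi))]
  ring

theorem integral_bracket_eq (hγ : IsStrictlyConvexCurve γ) {a b : ℝ} (hab : a < b)
    (hba : b < a + 2 * Real.pi) (ha : (deriv γ a).1 = 0) (hb : (deriv γ b).1 = 0)
    (hneg : ∀ x ∈ Ioo a b, (deriv γ x).1 < 0)
    (hpos : ∀ x ∈ Ioo b (a + 2 * Real.pi), 0 < (deriv γ x).1) :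
    ∫ x in a..(a + 2 * Real.pi), bracket (γ x) (deriv γ x) = 2 * enclosedArea γ := by
  have cf : Continuous fun t => (γ t).1 := continuous_fst.comp hγ.continuous
  have ch : Continuous fun t => (γ t).2 := continuous_snd.comp hγ.continuous
  have cf₁ : Continuous fun t => (deriv γ t).1 := continuous_fst.comp hγ.continuous_deriv
  have ch₁ : Continuous fun t => (deriv γ t).2 := continuous_snd.comp hγ.continuous_deriv
  -- The derivative of the product of the coordinates integrates to zero over a period, which
  -- symmetrizes `-∫ y dx` into half of `∫ P`.
  have hparts : ∫ x in a..(a + 2 * Real.pi), ((deriv γ x).1 * (γ x).2 + (γ x).1 * (deriv γ x).2)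
      = 0 := by
    rw [intervalIntegral.integral_eq_sub_of_hasDerivAt
      (fun x _ => (hγ.hasDerivAt_fst x).mul (hγ.hasDerivAt_snd x))
      (((cf₁.mul ch).add (cf.mul ch₁)).intervalIntegrable _ _)]
    simp [hγ.periodic a]
  have hsub : ∫ x in a..(a + 2 * Real.pi), bracket (γ x) (deriv γ x) =
      (∫ x in a..(a + 2 * Real.pi), ((deriv γ x).1 * (γ x).2 + (γ x).1 * (deriv γ x).2)) -
        2 * ∫ x in a..(a + 2 * Real.pi), (γ x).2 * (deriv γ x).1 := by
    have c₁ : Continuous fun x => (deriv γ x).1 * (γ x).2 + (γ x).1 * (deriv γ x).2 :=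
      (cf₁.mul ch).add (cf.mul ch₁)
    have c₂ : Continuous fun x => 2 * ((γ x).2 * (deriv γ x).1) := (ch.mul cf₁).const_mul 2
    rw [← intervalIntegral.integral_const_mul, ← intervalIntegral.integral_sub
      (c₁.intervalIntegrable _ _) (c₂.intervalIntegrable _ _)]
    refine intervalIntegral.integral_congr fun x _ => ?_
    simp only [bracket]
    ring
  rw [hsub, hparts, hγ.enclosedArea_eq_integral_snd_mul hab hba ha hb hneg hpos]
  ring

theorem enclosedArea_le_of_bracket_le (hγ : IsStrictlyConvexCurve γ) {l : ℝ} (hl : 0 < l)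
    (hle : ∀ x, bracket (γ x) (deriv γ x) ^ 3 ≤
      l ^ 2 * bracket (deriv γ x) (deriv (deriv γ) x)) :
    enclosedArea γ ≤ l * Real.pi := by
  obtain ⟨a, b, hab, hba, ha, hb, hneg, hpos⟩ := hγ.exists_monotone_arcs
  have h0 := hγ.integral_bracket_eq hab hba ha hb hneg hpos
  rw [← intervalIntegral.integral_add_adjacent_intervals
    (hγ.continuous_bracket_deriv.intervalIntegrable a b)
    (hγ.continuous_bracket_deriv.intervalIntegrable b _)] at h0
  have h1 := integral_le_of_pruefer hl hab hγ.hasDerivAt_fst hγ.hasDerivAt_snd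
    hγ.hasDerivAt_deriv_fst hγ.hasDerivAt_deriv_snd (fun x hx => (hneg x hx).ne) hle
  have h2 := integral_le_of_pruefer hl hba hγ.hasDerivAt_fst hγ.hasDerivAt_snd
    hγ.hasDerivAt_deriv_fst hγ.hasDerivAt_deriv_snd (fun x hx => (hpos x hx).ne') hle
  simp only [bracket] at h0
  linarith

theorem le_enclosedArea_of_le_bracket (hγ : IsStrictlyConvexCurve γ) {l : ℝ} (hl : 0 < l)
    (hP : ∀ x, 0 < bracket (γ x) (deriv γ x))
    (hle : ∀ x, l ^ 2 * bracket (deriv γ x) (deriv (deriv γ) x) ≤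
      bracket (γ x) (deriv γ x) ^ 3) :
    l * Real.pi ≤ enclosedArea γ := by
  obtain ⟨a, b, hab, hba, ha, hb, hneg, hpos⟩ := hγ.exists_monotone_arcs
  obtain ⟨K, hc, hK, hf⟩ := hγ.convex
  have hmem : ∀ t, γ t ∈ K := fun t => hc.isClosed.frontier_subset (hf ▸ mem_range_self t)
  have h0 := hγ.integral_bracket_eq hab hba ha hb hneg hpos
  have hap : γ (a + 2 * Real.pi) = γ a := hγ.periodic a
  have hap₁ : deriv γ (a + 2 * Real.pi) = deriv γ a := hγ.periodic_deriv a
  have hlt : (γ b).1 < (γ a).1 :=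
    strictAntiOn_of_deriv_neg (convex_Icc a b)
      (f := fun t => (γ t).1) (continuous_fst.comp hγ.continuous).continuousOn
      (fun x hx => by
        rw [(hγ.hasDerivAt_fst x).deriv]
        exact hneg x (by rwa [interior_Icc] at hx))
      (left_mem_Icc.2 hab.le) (right_mem_Icc.2 hab.le) hab
  -- At the rightmost point the tangent is vertical and, as `K` lies to its left, points upward; `P
  -- > 0` then gives the sign of the abscissa. The leftmost point is symmetric.
  have hfa : 0 < (γ a).1 := by
    have h1 := hP a
    have h2 := hγ.bracket_sub_nonneg hc hK hf a (hmem b)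
    simp only [bracket, ha, Prod.fst_sub, Prod.snd_sub, mul_zero, sub_zero, zero_mul] at h1 h2
    have h3 : 0 ≤ (deriv γ a).2 := by
      by_contra! h
      nlinarith
    exact pos_of_mul_pos_left h1 h3
  have hfb : (γ b).1 < 0 := by
    have h1 := hP b
    have h2 := hγ.bracket_sub_nonneg hc hK hf b (hmem a)
    simp only [bracket, hb, Prod.fst_sub, Prod.snd_sub, mul_zero, sub_zero, zero_mul] at h1 h2
    have h3 : (deriv γ b).2 ≤ 0 := by
      by_contra! h
      nlinarith
    by_contra! h
    nlinarith
  rw [← intervalIntegral.integral_add_adjacent_intervals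
    (hγ.continuous_bracket_deriv.intervalIntegrable a b)
    (hγ.continuous_bracket_deriv.intervalIntegrable b _)] at h0
  have h1 := le_integral_of_pruefer hl hab hγ.hasDerivAt_fst hγ.hasDerivAt_snd
    hγ.hasDerivAt_deriv_fst hγ.hasDerivAt_deriv_snd hneg ha hb hP hfa hfb hle
  -- The first coordinate increases on the second arc, so the comparison is applied to `-γ`, which
  -- has the same `P` and `B`.
  have h2 := le_integral_of_pruefer hl hba (fun x => (hγ.hasDerivAt_fst x).neg)
    (fun x => (hγ.hasDerivAt_snd x).neg) (fun x => (hγ.hasDerivAt_deriv_fst x).neg)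
    (fun x => (hγ.hasDerivAt_deriv_snd x).neg)
    (fun x hx => neg_neg_of_pos (hpos x hx)) (by simp [hb]) (by simp [hap₁, ha])
    (by simpa [bracket] using hP) (by simpa using hfb) (by simpa [hap] using hfa)
    (by simpa [bracket] using hle)
  simp only [Pi.neg_apply, neg_mul_neg] at h2
  simp only [bracket] at h0
  linarith

end IsStrictlyConvexCurve

/-! ### The affine support function and the conclusion -/

namespace IsStrictlyConvexCurve

variable {γ : ℝ → ℝ × ℝ}

theorem equiAffineMetric_pos (hγ : IsStrictlyConvexCurve γ) (x : ℝ) : 0 < equiAffineMetric γ x :=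
  Real.rpow_pos_of_pos (hγ.bracket_pos x) _

theorem equiAffineMetric_pow_three (hγ : IsStrictlyConvexCurve γ) (x : ℝ) :
    equiAffineMetric γ x ^ 3 = bracket (deriv γ x) (deriv (deriv γ) x) := by
  rw [equiAffineMetric, ← Real.rpow_natCast, ← Real.rpow_mul (hγ.bracket_pos x).le]
  norm_num

theorem affineSupport_mul_equiAffineMetric (hγ : IsStrictlyConvexCurve γ) (x : ℝ) :
    affineSupport γ x * equiAffineMetric γ x = bracket (γ x) (deriv γ x) := by
  have := (hγ.equiAffineMetric_pos x).ne'
  simp only [affineSupport, equiAffineTangent, bracket, Prod.smul_fst, Prod.smul_snd, smul_eq_mul]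
  field_simp

/-- Translates bounds on `σ` into the hypotheses of the comparison, with `l ^ 2 = c ^ 3`. -/
theorem bracket_pow_three (hγ : IsStrictlyConvexCurve γ) (x : ℝ) :
    bracket (γ x) (deriv γ x) ^ 3 =
      affineSupport γ x ^ 3 * bracket (deriv γ x) (deriv (deriv γ) x) := by
  rw [← hγ.affineSupport_mul_equiAffineMetric, mul_pow, hγ.equiAffineMetric_pow_three]

theorem continuous_affineSupport (hγ : IsStrictlyConvexCurve γ) :
    Continuous (affineSupport γ) := by
  have hB : Continuous fun x => bracket (deriv γ x) (deriv (deriv γ) x) :=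
    ((continuous_fst.comp hγ.continuous_deriv).mul
      (continuous_snd.comp hγ.continuous_deriv_deriv)).sub
    ((continuous_snd.comp hγ.continuous_deriv).mul
      (continuous_fst.comp hγ.continuous_deriv_deriv))
  have hg : Continuous (equiAffineMetric γ) :=
    hB.rpow_const fun x => Or.inl (hγ.bracket_pos x).ne'
  have e : affineSupport γ = fun x => bracket (γ x) (deriv γ x) / equiAffineMetric γ x :=
    funext fun x => by
      rw [← hγ.affineSupport_mul_equiAffineMetric,
        mul_div_cancel_right₀ _ (hγ.equiAffineMetric_pos x).ne']
  rw [e]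
  exact hγ.continuous_bracket_deriv.div hg fun x => (hγ.equiAffineMetric_pos x).ne'

theorem periodic_affineSupport (hγ : IsStrictlyConvexCurve γ) :
    Function.Periodic (affineSupport γ) (2 * Real.pi) := fun x => by
  have h2 : deriv (deriv γ) (x + 2 * Real.pi) = deriv (deriv γ) x := by
    rw [← deriv_comp_add_const, hγ.periodic_deriv.funext]
  simp only [affineSupport, equiAffineTangent, equiAffineMetric, h2, hγ.periodic x,
    hγ.periodic_deriv x]

theorem exists_forall_affineSupport_le (hγ : IsStrictlyConvexCurve γ) :
    ∃ x, ∀ y, affineSupport γ y ≤ affineSupport γ x := by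
  obtain ⟨x, -, hx⟩ := (isCompact_Icc (a := 0) (b := 2 * Real.pi)).exists_isMaxOn
    (nonempty_Icc.2 Real.two_pi_pos.le) hγ.continuous_affineSupport.continuousOn
  refine ⟨x, fun y => ?_⟩
  obtain ⟨z, hz, hyz⟩ := hγ.periodic_affineSupport.exists_mem_Ico₀ Real.two_pi_pos y
  exact hyz ▸ hx (Ico_subset_Icc_self hz)

theorem exists_forall_le_affineSupport (hγ : IsStrictlyConvexCurve γ) :
    ∃ x, ∀ y, affineSupport γ x ≤ affineSupport γ y := by
  obtain ⟨x, -, hx⟩ := (isCompact_Icc (a := 0) (b := 2 * Real.pi)).exists_isMinOn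
    (nonempty_Icc.2 Real.two_pi_pos.le) hγ.continuous_affineSupport.continuousOn
  refine ⟨x, fun y => ?_⟩
  obtain ⟨z, hz, hyz⟩ := hγ.periodic_affineSupport.exists_mem_Ico₀ Real.two_pi_pos y
  exact hyz ▸ hx (Ico_subset_Icc_self hz)

theorem enclosedArea_pos (hγ : IsStrictlyConvexCurve γ) : 0 < enclosedArea γ := by
  obtain ⟨K, hc, hK, hf⟩ := hγ.convex
  rw [enclosedArea_eq hc hK hf, measureReal_def]
  refine ENNReal.toReal_pos ?_ hc.measure_lt_top.ne
  exact (Measure.measure_pos_of_nonempty_interior _ (hγ.interior_nonempty hc hK hf)).ne'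

/-- If `σ ≤ c` along the curve, then `A ≤ π c ^ (3/2)`. -/
theorem sq_enclosedArea_le (hγ : IsStrictlyConvexCurve γ) {c : ℝ} (hc : 0 < c)
    (h : ∀ x, affineSupport γ x ≤ c) : enclosedArea γ ^ 2 ≤ c ^ 3 * Real.pi ^ 2 := by
  have hc3 : 0 < c ^ 3 := by positivity
  have hA := hγ.enclosedArea_le_of_bracket_le (l := √(c ^ 3)) (Real.sqrt_pos.2 hc3) fun x => by
    rw [Real.sq_sqrt hc3.le, hγ.bracket_pow_three]
    exact mul_le_mul_of_nonneg_right ((Odd.strictMono_pow (by decide : Odd 3)).monotone (h x))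
      (hγ.bracket_pos x).le
  calc enclosedArea γ ^ 2 ≤ (√(c ^ 3) * Real.pi) ^ 2 :=
        pow_le_pow_left₀ hγ.enclosedArea_pos.le hA 2
    _ = c ^ 3 * Real.pi ^ 2 := by rw [mul_pow, Real.sq_sqrt hc3.le]

/-- If `σ ≥ c > 0` along the curve, then `A ≥ π c ^ (3/2)`. -/
theorem le_sq_enclosedArea (hγ : IsStrictlyConvexCurve γ) {c : ℝ} (hc : 0 < c)
    (h : ∀ x, c ≤ affineSupport γ x) : c ^ 3 * Real.pi ^ 2 ≤ enclosedArea γ ^ 2 := by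
  have hc3 : 0 < c ^ 3 := by positivity
  have hA := hγ.le_enclosedArea_of_le_bracket (l := √(c ^ 3)) (Real.sqrt_pos.2 hc3)
    (fun x => by
      rw [← hγ.affineSupport_mul_equiAffineMetric]
      exact mul_pos (hc.trans_le (h x)) (hγ.equiAffineMetric_pos x))
    fun x => by
      rw [Real.sq_sqrt hc3.le, hγ.bracket_pow_three]
      exact mul_le_mul_of_nonneg_right (pow_le_pow_left₀ hc.le (h x) 3) (hγ.bracket_pos x).le
  calc c ^ 3 * Real.pi ^ 2 = (√(c ^ 3) * Real.pi) ^ 2 := by rw [mul_pow, Real.sq_sqrt hc3.le]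
    _ ≤ enclosedArea γ ^ 2 := pow_le_pow_left₀ (by positivity) hA 2

end IsStrictlyConvexCurve

theorem mainTheorem7 (γ : ℝ → ℝ × ℝ) (hγ : IsStrictlyConvexCurve γ)
    (A₀ : ℝ) (hA₀ : enclosedArea γ = A₀) :
    ∃ x₀ : ℝ, affineSupport γ x₀ = Real.pi ^ (-(2 / 3) : ℝ) * A₀ ^ (2 / 3 : ℝ) := by
  subst hA₀
  have hA := hγ.enclosedArea_pos
  have hπ := Real.pi_pos
  set c : ℝ := Real.pi ^ (-(2 / 3) : ℝ) * enclosedArea γ ^ (2 / 3 : ℝ) with hcdef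
  have hc : 0 < c := mul_pos (Real.rpow_pos_of_pos hπ _) (Real.rpow_pos_of_pos hA _)
  have hc3 : c ^ 3 * Real.pi ^ 2 = enclosedArea γ ^ 2 := by
    have h1 : (Real.pi ^ (-(2 / 3) : ℝ)) ^ 3 = (Real.pi ^ 2)⁻¹ := by
      rw [← Real.rpow_natCast, ← Real.rpow_mul hπ.le, ← Real.rpow_natCast, ← Real.rpow_neg hπ.le]
      norm_num
    have h2 : (enclosedArea γ ^ (2 / 3 : ℝ)) ^ 3 = enclosedArea γ ^ 2 := by
      rw [← Real.rpow_natCast, ← Real.rpow_mul hA.le, ← Real.rpow_natCast]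
      norm_num
    rw [hcdef, mul_pow, h1, h2]
    field_simp
  refine mem_range_of_exists_le_of_exists_ge hγ.continuous_affineSupport ?_ ?_
  · by_contra! h
    -- The minimum of `σ` is itself a constant strictly above `c`, which makes the area bound
    -- strict.
    obtain ⟨x, hx⟩ := hγ.exists_forall_le_affineSupport
    have h1 := hγ.le_sq_enclosedArea (hc.trans (h x)) hx
    have h2 := pow_lt_pow_left₀ (h x) hc.le three_ne_zero
    have h3 : 0 < Real.pi ^ 2 := by positivity
    nlinarith
  · by_contra! h
    obtain ⟨x, hx⟩ := hγ.exists_forall_affineSupport_le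
    -- The area bound needs a positive constant, while the maximum of `σ` is not yet known to be
    -- positive; hence `d` strictly between `max (σ x) 0` and `c`.
    obtain ⟨d, hd, hdc⟩ := exists_between (max_lt (h x) hc)
    have hd0 : 0 < d := (le_max_right _ _).trans_lt hd
    have h1 := hγ.sq_enclosedArea_le hd0 fun y => (hx y).trans ((le_max_left _ _).trans hd.le)
    have h2 := pow_lt_pow_left₀ hdc hd0.le three_ne_zero
    have h3 : 0 < Real.pi ^ 2 := by positivity
    nlinarith
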